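/- Encode opening and closing brackets by $+$ and $-$. A \emph{re-pairing} of a Dyck word $\sigma$ of length $N$ is a sequence $p=(p_1,\dots,p_{N/2})$ of pairs $p_i=(\ell_i,r_i)$ of positions such that $\sigma(\ell_i)=+$, $\sigma(r_i)=-$ and $\ell_i<r_i$ for all $i$, and every position in $[1,N]$ occurs in exactly one pair. The width of a finite set of integers is the smallest number of intervals $[a,b]=\{x\in\mathbb Z: a\le x\le b\}$ whose union it is. The width of $p$ is the maximum over $t$ of the width of the set $\{\ell_i,r_i : i\le t\}$, and $\operatorname{width}(\sigma)$ is the minimum width of a re-pairing of $\sigma$. For positive integers $a_0,a_1,\dots$ let $X(a_0)={+}^{a_0}{-}^{a_0}$ and $X(a_0,\dots,a_k)={+}^{a_k}X(a_0,\dots,a_{k-1})X(a_0,\dots,a_{k-1}){-}^{a_k}$. For $\ell\ge 2$ let $Y(\ell)=X(a_0,\dots,a_{m\ell-1})$, where $m=\lfloor \ell\log_2\ell\rfloor$ and $a_i=2^{\lfloor i/\ell\rfloor}$. **Theorem.** The Dyck words $Y(\ell)$ satisfy, as $\ell\to\infty$, $$\operatorname{width}(Y(\ell))=\Omega\left(\sqrt{\frac{\log|Y(\ell)|}{\log\log|Y(\ell)|}}\right)\qquad\text{and}\qquad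 \operatorname{width}(Y(\ell))=\Omega(\ell),$$ and these two bounds are equivalent: $\sqrt{\log|Y(\ell)|/\log\log|Y(\ell)|}=\Theta(\ell)$. Here $|\cdot|$ denotes length and $\log$ is the binary logarithm. -/

import Mathlib

namespace Dyck

/-- The width of a set `S` of integers: the smallest number of intervals
`[a, b] = {x : ℤ | a ≤ x ≤ b}` whose union is equal to `S`. It is applied to finite sets only,
for which such a number exists. -/
noncomputable def setWidth (S : Set ℤ) : ℕ :=
  sInf {k : ℕ | ∃ I : Fin k → ℤ × ℤ, S = ⋃ i, Set.Icc (I i).1 (I i).2}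

/-- A re-pairing of a Dyck word `σ` of length `N`: a sequence of `N / 2` pairs `(left i, right i)`
of positions such that `left i` carries an opening bracket, `right i` a closing one,
`left i < right i`, and every position occurs in exactly one pair.
Positions and times are counted from `0`. -/
structure RePairing (σ : DyckWord) where
  left : Fin (σ.toList.length / 2) → Fin σ.toList.length
  right : Fin (σ.toList.length / 2) → Fin σ.toList.length
  left_open : ∀ i, σ.toList.get (left i) = DyckStep.U
  right_close : ∀ i, σ.toList.get (right i) = DyckStep.D
  left_lt_right : ∀ i, left i < right i
  exactly_one : ∀ b : Fin σ.toList.length, ∃! i, b = left i ∨ b = right i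

/-- The set of the positions erased by the first `t` pairs of a re-pairing. -/
def RePairing.erased {σ : DyckWord} (p : RePairing σ) (t : ℕ) : Set ℤ :=
  {b : ℤ | ∃ i : Fin (σ.toList.length / 2), (i : ℕ) < t ∧
    (b = ((p.left i : ℕ) : ℤ) ∨ b = ((p.right i : ℕ) : ℤ))}

/-- The width of a re-pairing: the maximum over all times `t = 0, …, N / 2` of the width of the
set of the positions erased up to time `t`. -/
noncomputable def RePairing.width {σ : DyckWord} (p : RePairing σ) : ℕ :=
  (Finset.range (σ.toList.length / 2 + 1)).sup fun t => setWidth (p.erased t)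

/-- The width of a Dyck word: the minimum of the widths of its re-pairings
(every Dyck word has one). -/
noncomputable def width (σ : DyckWord) : ℕ :=
  sInf (Set.range fun p : RePairing σ => p.width)

/-- The word `+ᵃ w -ᵃ`. -/
def frame (a : ℕ) (w : DyckWord) : DyckWord where
  toList := List.replicate a DyckStep.U ++ w.toList ++ List.replicate a DyckStep.D
  count_U_eq_count_D := by
    have h := w.count_U_eq_count_D
    simp [List.count_replicate, h]
    omega
  count_D_le_count_U i := by
    have h := w.count_U_eq_count_D
    have h' := w.count_D_le_count_U (i - a)
    rcases le_or_gt i (a + w.toList.length) with hi | hi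
    · simp [List.take_append, List.take_replicate, List.count_replicate]
      omega
    · have h1 : w.toList.take (i - a) = w.toList := List.take_of_length_le (by omega)
      simp [List.take_append, List.take_replicate, List.count_replicate, h1, h]
      omega

/-- The word `X(a₀, …, aₖ)`: `X(a₀) = +^a₀ -^a₀` and
`X(a₀, …, aₖ₊₁) = +^aₖ₊₁ X(a₀, …, aₖ) X(a₀, …, aₖ) -^aₖ₊₁`
(in Mathlib, the sum of Dyck words is concatenation and `0` is the empty word). -/
def X (a : ℕ → ℕ) : ℕ → DyckWord
  | 0 => frame (a 0) 0
  | k + 1 => frame (a (k + 1)) (X a k + X a k)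

/-- The word `Y(m, ℓ) = X(a₀, …, a_{mℓ-1})` with `aᵢ = 2 ^ ⌊i / ℓ⌋`, for `m ≥ 1` and `ℓ ≥ 1`. -/
def Y₂ (m ℓ : ℕ) : DyckWord := X (fun i => 2 ^ (i / ℓ)) (m * ℓ - 1)

/-- The word `Y(ℓ) = Y(⌊ℓ log₂ ℓ⌋, ℓ)`, for `ℓ ≥ 2` (so that `⌊ℓ log₂ ℓ⌋ ≥ 1`). -/
noncomputable def Y (ℓ : ℕ) : DyckWord := Y₂ ⌊(ℓ : ℝ) * Real.logb 2 ℓ⌋₊ ℓ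

/-- The quantity `√(log |σ| / log log |σ|)`, with binary logarithms. -/
noncomputable def sqrtLogRatio (σ : DyckWord) : ℝ :=
  Real.sqrt (Real.logb 2 (σ.toList.length : ℝ) /
    Real.logb 2 (Real.logb 2 (σ.toList.length : ℝ)))

end Dyck

/- A pair straddling a cut carries one unit of flow through it. On an erased interval the flow
changes like the height of the word, on an interval without erased positions it is constant, and on
a copy of a small tree `X(a₀, …, a_L)` it changes by at most `w` times the height of the tree, if
there are at most `w` runs of erased positions.

Suppose that a large copy is erased *quietly* in a window `[l, r)`, i.e. that meanwhile no pair
straddles `l` or `r`. Choose two small copies in each half of it, and suppose that each of them is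
*critical* at some time: partly erased, with all runs of the window attached to it. If a position
beyond the valley between the halves is erased at such a time, the run that attaches it to the copy
raises the flow on its way up from the valley. The far end of the run lies high in the same half,
since the other copy there blocks it, and the excess flow has to leave the window: a contradiction.
Hence neither half is touched before the times of the other one, which is absurd for the earliest
of the four times. So one of the small copies is never critical, and while it is partly erased some
run of the window always lies outside of it.

The non-critical copy contains more than `2 H (2 w + 2)` copies of a still smaller tree, where `H`
bounds the height. At most `2 H` pairs straddle its ends, and while one such pair is formed at most
`2 w + 2` of the copies are partly erased, so that one of the copies is erased quietly in the
non-critical one. Recursion gives one run per level. For `Y(ℓ)` a level costs a number of indices of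
order `ℓ log ℓ` out of the `⌊ℓ log ℓ⌋ ℓ` that there are, which leaves of order `ℓ` levels. -/

namespace Dyck

open Finset

/-- The number of opening minus the number of closing brackets among the first `x` letters of `u`.
Positions are integers, so that words can be read backwards; the height is constant to the left
and to the right of the word. -/
def height (u : List DyckStep) (x : ℤ) : ℤ :=
  ((u.take x.toNat).count DyckStep.U : ℤ) - (u.take x.toNat).count DyckStep.D

lemma height_of_nonpos (u : List DyckStep) {x : ℤ} (hx : x ≤ 0) : height u x = 0 := by
  simp [height, Int.toNat_of_nonpos hx]

lemma height_of_length_le (u : List DyckStep) {x : ℤ} (hx : u.length ≤ x) :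
    height u x = height u u.length := by
  simp [height, List.take_of_length_le (show u.length ≤ x.toNat by omega)]

lemma height_append (u v : List DyckStep) (x : ℤ) :
    height (u ++ v) x = height u x + height v (x - u.length) := by
  have hx : (x - u.length).toNat = x.toNat - u.length := by omega
  simp only [height, hx, List.take_append, List.count_append]
  push_cast
  ring

lemma height_replicate_U (a : ℕ) (x : ℤ) :
    height (List.replicate a DyckStep.U) x = min x.toNat a := by
  simp [height, List.take_replicate, List.count_replicate]

lemma height_replicate_D (a : ℕ) (x : ℤ) :
    height (List.replicate a DyckStep.D) x = -min x.toNat a := by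
  simp [height, List.take_replicate, List.count_replicate]

lemma height_add_one (u : List DyckStep) (i : Fin u.length) :
    height u (i + 1) = height u i + if u.get i = DyckStep.U then 1 else -1 := by
  have htake : u.take (i + 1) = u.take i ++ [u.get i] := by simp
  have hi : ((i : ℤ) + 1).toNat = i + 1 := by omega
  simp only [height, hi, Int.toNat_natCast, htake, List.count_append, List.count_singleton]
  rcases u.get i with _ | _ <;>
    simp only [reduceCtorEq, beq_self_eq_true, beq_iff_eq, if_true, if_false] <;> push_cast <;> ring

lemma height_nonneg (w : DyckWord) (x : ℤ) : 0 ≤ height w.toList x := by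
  have := w.count_D_le_count_U x.toNat
  simp only [height]
  omega

lemma height_length (w : DyckWord) : height w.toList w.toList.length = 0 := by
  simp [height, w.count_U_eq_count_D]

lemma height_frame_le {w : DyckWord} {H : ℤ} (hw : ∀ x, height w.toList x ≤ H) (a : ℕ) (x : ℤ) :
    height (frame a w).toList x ≤ H + a := by
  simp only [frame, height_append, height_replicate_U, height_replicate_D]
  have := hw (x - (List.replicate a DyckStep.U).length)
  omega

lemma height_add_le {w w' : DyckWord} {H : ℤ} (hw : ∀ x, height w.toList x ≤ H)
    (hw' : ∀ x, height w'.toList x ≤ H) (x : ℤ) : height (w + w').toList x ≤ H := by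
  have happend : height (w + w').toList x =
      height w.toList x + height w'.toList (x - w.toList.length) := height_append _ _ _
  rcases le_total x w.toList.length with hx | hx
  · rw [happend, height_of_nonpos w'.toList (by omega), add_zero]
    exact hw x
  · rw [happend, height_of_length_le w.toList hx, height_length, zero_add]
    exact hw' _

lemma height_X_le (a : ℕ → ℕ) (L : ℕ) (x : ℤ) :
    height (X a L).toList x ≤ ∑ i ∈ range (L + 1), a i := by
  induction L generalizing x with
  | zero =>
    have hnil : (0 : DyckWord).toList = [] := rfl
    simpa [X] using height_frame_le (w := 0) (H := 0) (fun x => by simp [height, hnil]) (a 0) x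
  | succ L ih =>
    rw [sum_range_succ]
    push_cast at ih ⊢
    exact height_frame_le (height_add_le ih ih) _ _

/-- The length of `X(a₀, …, a_L)`. -/
def len (a : ℕ → ℕ) (L : ℕ) : ℕ := (X a L).toList.length

lemma len_zero (a : ℕ → ℕ) : len a 0 = 2 * a 0 := by
  have hnil : (0 : DyckWord).toList = [] := rfl
  simp [len, X, frame, hnil, two_mul]

lemma len_succ (a : ℕ → ℕ) (L : ℕ) : len a (L + 1) = 2 * len a L + 2 * a (L + 1) := by
  have hadd : (X a L + X a L).toList = (X a L).toList ++ (X a L).toList := rfl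
  simp only [len, X, frame, hadd, List.length_append, List.length_replicate]
  ring

lemma two_pow_le_len {a : ℕ → ℕ} (ha : ∀ i, 0 < a i) (L : ℕ) : 2 ^ (L + 1) ≤ len a L := by
  induction L with
  | zero => rw [len_zero]; have := ha 0; omega
  | succ L ih => rw [len_succ, pow_succ]; omega

lemma len_pos {a : ℕ → ℕ} (ha : ∀ i, 0 < a i) (L : ℕ) : 0 < len a L :=
  (Nat.two_pow_pos _).trans_le (two_pow_le_len ha L)

lemma len_le (a : ℕ → ℕ) (L : ℕ) : len a L ≤ 2 ^ (L + 1) * ∑ i ∈ range (L + 1), a i := by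
  induction L with
  | zero => simp [len_zero]
  | succ L ih =>
    rw [len_succ, sum_range_succ, pow_succ, mul_add]
    have : 1 ≤ 2 ^ (L + 1) := Nat.one_le_two_pow
    nlinarith

/-- The function `h` runs from the position `p` on through the heights of `u`. If `h` is the height
of a word, this says that `u` is a factor of that word at the position `p`. -/
def Occurs (h : ℤ → ℤ) (u : List DyckStep) (p : ℤ) : Prop :=
  ∀ x, p ≤ x → x ≤ p + u.length → h x = h p + height u (x - p)

namespace Occurs

variable {h : ℤ → ℤ} {u v : List DyckStep} {w w' : DyckWord} {a : ℕ} {p x : ℤ}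

lemma height_self (u : List DyckStep) : Occurs (height u) u 0 := fun x _ _ => by
  simp [height_of_nonpos u le_rfl]

lemma append_left (hp : Occurs h (u ++ v) p) : Occurs h u p := fun x hpx hx => by
  rw [hp x hpx (by rw [List.length_append]; push_cast; omega), height_append,
    height_of_nonpos v (by omega), add_zero]

lemma append_right (hp : Occurs h (u ++ v) p) : Occurs h v (p + u.length) := fun x hpx hx => by
  have hmid := hp.append_left (p + u.length) (by omega) le_rfl
  rw [hp x (by omega) (by rw [List.length_append]; push_cast; omega), height_append,
    height_of_length_le u (by omega), hmid, add_sub_cancel_left, sub_sub, add_assoc]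

lemma le (hp : Occurs h w.toList p) (hpx : p ≤ x) (hx : x ≤ p + w.toList.length) : h p ≤ h x := by
  rw [hp x hpx hx]
  linarith [height_nonneg w (x - p)]

lemma height_end (hp : Occurs h w.toList p) : h (p + w.toList.length) = h p := by
  rw [hp _ (by omega) le_rfl, add_sub_cancel_left, height_length, add_zero]

lemma height_of_frame (hp : Occurs h (frame a w).toList p) : h (p + a) = h p + a := by
  have hprefix : Occurs h (List.replicate a DyckStep.U) p := hp.append_left.append_left
  rw [hprefix (p + a) (by omega) (by simp), height_replicate_U]
  simp

lemma of_frame (hp : Occurs h (frame a w).toList p) : Occurs h w.toList (p + a) := by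
  simpa using hp.append_left.append_right

lemma fst (hp : Occurs h (frame a (w + w')).toList p) : Occurs h w.toList (p + a) :=
  hp.of_frame.append_left

lemma snd (hp : Occurs h (frame a (w + w')).toList p) :
    Occurs h w'.toList (p + a + w.toList.length) :=
  hp.of_frame.append_right

lemma height_sub_le {L : ℕ} {a : ℕ → ℕ} (hp : Occurs h (X a L).toList p) (hpx : p ≤ x)
    (hx : x ≤ p + len a L) : h x ≤ h p + ∑ i ∈ range (L + 1), a i := by
  rw [hp x hpx hx]
  linarith [height_X_le a L (x - p)]

lemma exists_copies {L d : ℕ} {a : ℕ → ℕ} (ha : ∀ i, 0 < a i)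
    (hp : Occurs h (X a (L + d)).toList p) :
    ∃ Q : Finset ℤ, #Q = 2 ^ d ∧ (Q : Set ℤ).PairwiseDisjoint (fun q => Ico q (q + len a L)) ∧
      ∀ q ∈ Q, Occurs h (X a L).toList q ∧ p ≤ q ∧ q + len a L ≤ p + len a (L + d) := by
  induction d generalizing p with
  | zero => exact ⟨{p}, by simp, by simp, by simpa using hp⟩
  | succ d ih =>
    rw [← add_assoc] at hp ⊢
    obtain ⟨Q, hQcard, hQdisj, hQ⟩ := ih hp.fst
    obtain ⟨Q', hQ'card, hQ'disj, hQ'⟩ := ih hp.snd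
    have hlen := len_succ a (L + d)
    have hpos := len_pos ha L
    rw [← len] at hQ'
    have hcross : ∀ q ∈ Q, ∀ q' ∈ Q', q + len a L ≤ q' := fun q hq q' hq' => by
      have := hQ q hq
      have := hQ' q' hq'
      omega
    refine ⟨Q ∪ Q', ?_, ?_, fun q hq => ?_⟩
    · rw [card_union_of_disjoint, hQcard, hQ'card, pow_succ, mul_two]
      exact disjoint_left.2 fun q hq hq' => by have := hcross q hq q hq'; omega
    · rw [coe_union]
      refine hQdisj.union hQ'disj fun q hq q' hq' _ => disjoint_left.2 fun x hx hx' => ?_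
      have := hcross q hq q' hq'
      simp only [mem_Ico] at hx hx'
      omega
    · rcases mem_union.1 hq with hq | hq
      · obtain ⟨hocc, _, _⟩ := hQ q hq
        exact ⟨hocc, by omega, by omega⟩
      · obtain ⟨hocc, _, _⟩ := hQ' q hq
        exact ⟨hocc, by omega, by omega⟩

end Occurs

/-- The number of maximal runs of consecutive integers in `E`, counted by their last elements. -/
def runs (E : Finset ℤ) : ℕ := #{b ∈ E | b + 1 ∉ E}

section Runs

variable {E : Finset ℤ} {b c l r : ℤ}

lemma exists_step {p : ℤ → Prop} (hbc : b ≤ c) (hb : p b) (hc : ¬p c) :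
    ∃ x, b ≤ x ∧ x < c ∧ p x ∧ ¬p (x + 1) := by
  by_contra! hstep
  refine hc (Int.leInduction (motive := fun x _ => x ≤ c → p x) (fun _ => hb) ?_ c hbc le_rfl)
  exact fun x hbx ih hxc => hstep x hbx (by omega) (ih (by omega))

lemma exists_Ico_subset_notMem (hbc : b ≤ c) (hc : c ∉ E) :
    ∃ y, b ≤ y ∧ y ≤ c ∧ Ico b y ⊆ E ∧ y ∉ E := by
  obtain ⟨y, hby, hyc, hy, hy'⟩ := exists_step (p := fun y => Ico b y ⊆ E) (c := c + 1)
    (by omega : b ≤ c + 1) (by simp) fun h => hc (h (mem_Ico.2 ⟨hbc, by omega⟩))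
  refine ⟨y, hby, by omega, hy, fun hyE => hy' fun x hx => ?_⟩
  rcases eq_or_ne x y with rfl | hxy
  · exact hyE
  · exact hy (mem_Ico.2 (by have := mem_Ico.1 hx; omega))

lemma sum_map_add_one (E : Finset ℤ) (h : ℤ → ℤ) :
    ∑ x ∈ E.map (addRightEmbedding 1), h x = ∑ x ∈ E, h (x + 1) := by
  simp

lemma sum_sub_eq_sum_ends_sub_sum_starts (E : Finset ℤ) (h : ℤ → ℤ) :
    ∑ x ∈ E, (h (x + 1) - h x) =
      ∑ b ∈ E with b + 1 ∉ E, h (b + 1) - ∑ b ∈ E with b - 1 ∉ E, h b := by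
  have hends : ∑ b ∈ E with b + 1 ∉ E, h (b + 1) =
      ∑ x ∈ E.map (addRightEmbedding 1) \ E, h x := by
    rw [← sum_map_add_one]
    congr 1
    ext x
    simp only [mem_map, mem_filter, mem_sdiff, addRightEmbedding_apply]
    constructor
    · rintro ⟨b, ⟨hb, hb'⟩, rfl⟩
      exact ⟨⟨b, hb, rfl⟩, hb'⟩
    · rintro ⟨⟨b, hb, rfl⟩, hb'⟩
      exact ⟨b, ⟨hb, hb'⟩, rfl⟩
  have hstarts : ({b ∈ E | b - 1 ∉ E} : Finset ℤ) = E \ E.map (addRightEmbedding 1) := by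
    ext x
    simp [← eq_sub_iff_add_eq]
  rw [hends, hstarts, sum_sdiff_sub_sum_sdiff, sum_map_add_one, sum_sub_distrib]

lemma card_starts (E : Finset ℤ) : #{b ∈ E | b - 1 ∉ E} = runs E := by
  have := sum_sub_eq_sum_ends_sub_sum_starts E fun _ => 1
  simp only [sub_self, sum_const_zero, sum_const, nsmul_eq_mul, mul_one] at this
  rw [runs]
  omega

lemma abs_sum_sub_le {h : ℤ → ℤ} {lo H : ℤ}
    (hlo : ∀ x ∈ E, h x ∈ Set.Icc lo (lo + H) ∧ h (x + 1) ∈ Set.Icc lo (lo + H)) :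
    |∑ x ∈ E, (h (x + 1) - h x)| ≤ runs E * H := by
  set S : Finset ℤ := {b ∈ E | b - 1 ∉ E} with hS
  set T : Finset ℤ := {b ∈ E | b + 1 ∉ E} with hT
  have hsum : ∑ x ∈ E, (h (x + 1) - h x) = ∑ b ∈ T, (h (b + 1) - lo) - ∑ b ∈ S, (h b - lo) := by
    rw [sum_sub_eq_sum_ends_sub_sum_starts, sum_sub_distrib, sum_sub_distrib, sum_const, sum_const,
      ← hS, ← hT, hS, card_starts, hT, ← runs]
    ring
  have hTle : ∑ b ∈ T, (h (b + 1) - lo) ≤ runs E * H := by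
    rw [← nsmul_eq_mul]
    refine sum_le_card_nsmul _ _ _ fun b hb => ?_
    linarith [(hlo b (filter_subset _ _ hb)).2.2]
  have hSle : ∑ b ∈ S, (h b - lo) ≤ runs E * H := by
    rw [← nsmul_eq_mul, ← card_starts]
    refine sum_le_card_nsmul _ _ _ fun b hb => ?_
    linarith [(hlo b (filter_subset _ _ hb)).1.2]
  rw [hsum]
  exact abs_sub_le_of_nonneg_of_le
    (sum_nonneg fun b hb => sub_nonneg.2 (hlo b (filter_subset _ _ hb)).2.1) hTle
    (sum_nonneg fun b hb => sub_nonneg.2 (hlo b (filter_subset _ _ hb)).1.1) hSle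

lemma runs_pos (hE : E.Nonempty) : 0 < runs E := by
  refine card_pos.2 ⟨E.max' hE, mem_filter.2 ⟨E.max'_mem hE, fun hmem => ?_⟩⟩
  have := E.le_max' _ hmem
  omega

lemma runs_filter_le (E : Finset ℤ) (l : ℤ) :
    runs {x ∈ E | l ≤ x} = #{b ∈ {b ∈ E | b + 1 ∉ E} | l ≤ b} := by
  refine congrArg card (ext fun x => ?_)
  simp only [mem_filter, not_and, not_le]
  exact ⟨fun hx => ⟨⟨hx.1.1, fun hmem => by have := hx.2 hmem; omega⟩, hx.1.2⟩,
    fun hx => ⟨⟨hx.1.1, hx.2⟩, fun hmem => absurd hmem hx.1.2⟩⟩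

lemma runs_filter_lt (E : Finset ℤ) (r : ℤ) :
    runs {x ∈ E | x < r} = #{b ∈ {b ∈ E | b - 1 ∉ E} | b < r} := by
  rw [← card_starts]
  refine congrArg card (ext fun x => ?_)
  simp only [mem_filter, not_and, not_lt]
  exact ⟨fun hx => ⟨⟨hx.1.1, fun hmem => by have := hx.2 hmem; omega⟩, hx.1.2⟩,
    fun hx => ⟨⟨hx.1.1, hx.2⟩, fun hmem => absurd hmem hx.1.2⟩⟩

lemma runs_filter_le_le (E : Finset ℤ) (l : ℤ) : runs {x ∈ E | l ≤ x} ≤ runs E :=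
  (runs_filter_le E l).trans_le (card_filter_le _ _)

lemma runs_filter_lt_le (E : Finset ℤ) (r : ℤ) : runs {x ∈ E | x < r} ≤ runs E := by
  rw [runs_filter_lt, ← card_starts]
  exact card_filter_le _ _

lemma runs_filter_le_lt (hb : b ∈ E) (hc : c ∉ E) (hbc : b ≤ c) (hcl : c ≤ l) :
    runs {x ∈ E | l ≤ x} < runs E := by
  obtain ⟨e, -, hec, he, he'⟩ := exists_step (p := (· ∈ E)) hbc hb hc
  rw [runs_filter_le]
  exact card_lt_card (filter_ssubset.2 ⟨e, mem_filter.2 ⟨he, he'⟩, by omega⟩)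

lemma runs_filter_lt_lt (hb : b ∈ E) (hc : c ∉ E) (hcb : c ≤ b) (hrc : r ≤ c) :
    runs {x ∈ E | x < r} < runs E := by
  obtain ⟨e, hce, -, he, he'⟩ := exists_step (p := (· ∉ E)) hcb hc (not_not.2 hb)
  rw [runs_filter_lt, ← card_starts]
  refine card_lt_card (filter_ssubset.2 ⟨e + 1, mem_filter.2 ⟨not_not.1 he', ?_⟩, by omega⟩)
  rwa [add_sub_cancel_right]

lemma inter_Ico_eq_filter_lt_filter_le (E : Finset ℤ) (l r : ℤ) :
    E ∩ Ico l r = {x ∈ {x ∈ E | l ≤ x} | x < r} := by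
  ext x
  simp [and_assoc]

lemma inter_Ico_eq_filter_le_filter_lt (E : Finset ℤ) (l r : ℤ) :
    E ∩ Ico l r = {x ∈ {x ∈ E | x < r} | l ≤ x} := by
  rw [inter_Ico_eq_filter_lt_filter_le, filter_comm]

lemma runs_inter_Ico_le (E : Finset ℤ) (l r : ℤ) : runs (E ∩ Ico l r) ≤ runs E := by
  rw [inter_Ico_eq_filter_lt_filter_le]
  exact (runs_filter_lt_le _ _).trans (runs_filter_le_le _ _)

lemma runs_inter_Ico_lt_of_left (hb : b ∈ E) (hc : c ∉ E) (hbc : b ≤ c) (hcl : c ≤ l) :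
    runs (E ∩ Ico l r) < runs E := by
  rw [inter_Ico_eq_filter_lt_filter_le]
  exact (runs_filter_lt_le _ _).trans_lt (runs_filter_le_lt hb hc hbc hcl)

lemma runs_inter_Ico_lt_of_right (hb : b ∈ E) (hc : c ∉ E) (hcb : c ≤ b) (hrc : r ≤ c) :
    runs (E ∩ Ico l r) < runs E := by
  rw [inter_Ico_eq_filter_le_filter_lt]
  exact (runs_filter_le_le _ _).trans_lt (runs_filter_lt_lt hb hc hcb hrc)

/-- The erased positions of `[l, r)` to the left and to the right of `[l', r')` are joined to
`[l', r')` by erased positions, so that they are part of no additional run. -/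
def Attached (E : Finset ℤ) (l r l' r' : ℤ) : Prop :=
  (∀ b ∈ E, l ≤ b → b < l' → Ico b l' ⊆ E) ∧ ∀ b ∈ E, r' ≤ b → b < r → Icc r' b ⊆ E

lemma attached_of_runs_le {l' r' : ℤ} (hl : l ≤ l') (hr : r' ≤ r) (hlr : l' ≤ r')
    (hruns : runs (E ∩ Ico l r) ≤ runs (E ∩ Ico l' r')) : Attached E l r l' r' := by
  have hsub : Ico l' r' ⊆ Ico l r := Ico_subset_Ico hl hr
  rw [← inter_eq_right.2 hsub, ← inter_assoc] at hruns
  constructor <;> intro b hb hlb hbr c hc <;> by_contra hcE <;> refine hruns.not_gt ?_ <;>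
    simp only [mem_Ico, mem_Icc] at hc
  · exact runs_inter_Ico_lt_of_left (mem_inter.2 ⟨hb, mem_Ico.2 ⟨hlb, by omega⟩⟩)
      (fun hmem => hcE (mem_inter.1 hmem).1) hc.1 hc.2.le
  · exact runs_inter_Ico_lt_of_right (mem_inter.2 ⟨hb, mem_Ico.2 ⟨by omega, hbr⟩⟩)
      (fun hmem => hcE (mem_inter.1 hmem).1) hc.2 hc.1

lemma exists_eq_iUnion_Icc (E : Finset ℤ) :
    ∃ k, ∃ I : Fin k → ℤ × ℤ, (E : Set ℤ) = ⋃ i, Set.Icc (I i).1 (I i).2 := by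
  refine ⟨#E, fun i => (E.equivFin.symm i, E.equivFin.symm i), Set.ext fun x => ?_⟩
  simp only [Set.Icc_self, Set.mem_iUnion, Set.mem_singleton_iff, mem_coe]
  exact ⟨fun hx => ⟨E.equivFin ⟨x, hx⟩, by simp⟩, by rintro ⟨i, rfl⟩; exact coe_mem _⟩

lemma runs_le_setWidth (E : Finset ℤ) : runs E ≤ setWidth E := by
  refine le_csInf (exists_eq_iUnion_Icc E) ?_
  rintro k ⟨I, hI⟩
  have hmem : ∀ x, x ∈ E ↔ ∃ i, (I i).1 ≤ x ∧ x ≤ (I i).2 := by simpa [Set.ext_iff] using hI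
  have hsub : ({b ∈ E | b + 1 ∉ E} : Finset ℤ) ⊆ univ.image fun i => (I i).2 := fun b hb => by
    obtain ⟨hbE, hb'⟩ := mem_filter.1 hb
    obtain ⟨i, hli, hri⟩ := (hmem b).1 hbE
    refine mem_image.2 ⟨i, mem_univ i, le_antisymm (not_lt.1 fun hlt => hb' ?_) hri⟩
    exact (hmem (b + 1)).2 ⟨i, by omega, hlt⟩
  simpa [runs] using (card_le_card hsub).trans card_image_le

/-- Each of these windows contains the first or the last element of a run of `E`, or an element of
`E' \ E`. -/
lemma card_cut_windows_le {Q : Finset ℤ} {n : ℤ}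
    (hQ : (Q : Set ℤ).PairwiseDisjoint fun q => Ico q (q + n)) (E E' : Finset ℤ) :
    #{q ∈ Q | ¬Disjoint E' (Ico q (q + n)) ∧ ¬Ico q (q + n) ⊆ E} ≤ 2 * runs E + #(E' \ E) := by
  set S : Finset ℤ := {b ∈ E | b - 1 ∉ E} with hS
  set T : Finset ℤ := {b ∈ E | b + 1 ∉ E} with hT
  set F := S ∪ T ∪ E' \ E
  set Q' := {q ∈ Q | ¬Disjoint E' (Ico q (q + n)) ∧ ¬Ico q (q + n) ⊆ E}
  have hcut : ∀ q ∈ Q', (F ∩ Ico q (q + n)).Nonempty := fun q hq => by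
    obtain ⟨-, hmeets, hnot⟩ := mem_filter.1 hq
    obtain ⟨b, hb, hbq⟩ := not_disjoint_iff.1 hmeets
    obtain ⟨c, hcq, hc⟩ := not_subset.1 hnot
    rw [mem_Ico] at hbq hcq
    by_cases hbE : b ∈ E
    · rcases le_total b c with hbc | hcb
      · obtain ⟨e, hbe, hec, he, he'⟩ := exists_step (p := (· ∈ E)) hbc hbE hc
        exact ⟨e, mem_inter.2 ⟨mem_union_left _ (mem_union_right _ (mem_filter.2 ⟨he, he'⟩)),
          mem_Ico.2 (by omega)⟩⟩
      · obtain ⟨e, hce, heb, he, he'⟩ := exists_step (p := (· ∉ E)) hcb hc (not_not.2 hbE)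
        have hstart : e + 1 ∈ S := mem_filter.2 ⟨not_not.1 he', by rwa [add_sub_cancel_right]⟩
        exact ⟨e + 1, mem_inter.2 ⟨mem_union_left _ (mem_union_left _ hstart),
          mem_Ico.2 (by omega)⟩⟩
    · exact ⟨b, mem_inter.2 ⟨mem_union_right _ (mem_sdiff.2 ⟨hb, hbE⟩), mem_Ico.2 (by omega)⟩⟩
  calc #Q' ≤ #(Q'.biUnion fun q => F ∩ Ico q (q + n)) :=
        card_le_card_biUnion ((hQ.subset (filter_subset _ _)).mono fun q => inter_subset_right) hcut
    _ ≤ #F := card_le_card (biUnion_subset.2 fun q _ => inter_subset_left)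
    _ ≤ #S + #T + #(E' \ E) := (card_union_le _ _).trans (by gcongr; exact card_union_le _ _)
    _ = 2 * runs E + #(E' \ E) := by rw [hS, card_starts, hT, ← runs, two_mul]

end Runs

lemma sum_Ico_add_one_sub (f : ℤ → ℤ) {l r : ℤ} (hlr : l ≤ r) :
    ∑ x ∈ Ico l r, (f (x + 1) - f x) = f r - f l := by
  induction r, hlr using Int.leInduction with
  | base => simp
  | succ r hlr ih =>
    rw [← Order.succ_eq_add_one, ← insert_Ico_right_eq_Ico_succ hlr, sum_insert (by simp), ih,
      Order.succ_eq_add_one]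
    ring

/-- What the lower bound uses of a re-pairing of a word with height function `h`: the positions
`erased t` erased up to the time `t`, and the number `flow t x` of the pairs formed up to the time
`t` that straddle the cut to the left of the position `x`. Such a pair contributes `+1` to the
height at its left end and `-1` at its right end, whence `flow_add_one`. -/
structure Erasure (h : ℤ → ℤ) where
  erased : ℕ → Finset ℤ
  flow : ℕ → ℤ → ℤ
  monotone_erased : Monotone erased
  card_sdiff_le : ∀ t, #(erased (t + 1) \ erased t) ≤ 2
  monotone_flow : ∀ x, Monotone fun t => flow t x
  flow_nonneg : ∀ t x, 0 ≤ flow t x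
  flow_le : ∀ t x, flow t x ≤ h x
  flow_add_one : ∀ t x, flow t (x + 1) = flow t x + if x ∈ erased t then h (x + 1) - h x else 0

namespace Erasure

variable {h : ℤ → ℤ} {P : Erasure h} {t : ℕ} {l r : ℤ}

lemma flow_sub_flow (P : Erasure h) (t : ℕ) (hlr : l ≤ r) :
    P.flow t r - P.flow t l = ∑ x ∈ P.erased t ∩ Ico l r, (h (x + 1) - h x) := by
  simp only [← sum_Ico_add_one_sub _ hlr, P.flow_add_one, add_sub_cancel_left]
  rw [← sum_filter, filter_mem_eq_inter, inter_comm]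

lemma flow_eq_of_disjoint (hlr : l ≤ r) (hdisj : Disjoint (P.erased t) (Ico l r)) :
    P.flow t r = P.flow t l := by
  rw [← sub_eq_zero, P.flow_sub_flow t hlr, disjoint_iff_inter_eq_empty.1 hdisj, sum_empty]

lemma flow_sub_flow_of_subset (hlr : l ≤ r) (hsub : Ico l r ⊆ P.erased t) :
    P.flow t r - P.flow t l = h r - h l := by
  rw [P.flow_sub_flow t hlr, inter_eq_right.2 hsub, sum_Ico_add_one_sub h hlr]

lemma abs_flow_sub_flow_le {lo H : ℤ} (P : Erasure h) (t : ℕ) (hlr : l ≤ r)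
    (hh : ∀ x ∈ Set.Icc l r, h x ∈ Set.Icc lo (lo + H)) :
    |P.flow t r - P.flow t l| ≤ runs (P.erased t ∩ Ico l r) * H := by
  rw [P.flow_sub_flow t hlr]
  refine abs_sum_sub_le (lo := lo) fun x hx => ?_
  have := mem_Ico.1 (mem_inter.1 hx).2
  exact ⟨hh x ⟨by omega, by omega⟩, hh (x + 1) ⟨by omega, by omega⟩⟩

/-- The same erasure read from right to left. The position `b` becomes `-1 - b`, since the letter
at `b` lies between the cuts `b` and `b + 1`, which become `-b` and `-b - 1`. -/
def reverse (P : Erasure h) : Erasure fun x => h (-x) where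
  erased t := (P.erased t).map (Equiv.subLeft (-1)).toEmbedding
  flow t x := P.flow t (-x)
  monotone_erased _ _ hst := map_subset_map.2 (P.monotone_erased hst)
  card_sdiff_le t := by
    rw [← Finset.map_sdiff, card_map]
    exact P.card_sdiff_le t
  monotone_flow x := P.monotone_flow (-x)
  flow_nonneg t x := P.flow_nonneg t (-x)
  flow_le t x := P.flow_le t (-x)
  flow_add_one t x := by
    have hflow := P.flow_add_one t (-1 - x)
    have hx : -(x + 1) = -1 - x := by ring
    have hx' : -1 - x + 1 = -x := by ring
    simp only [mem_map_equiv, Equiv.subLeft_symm_apply, hx, hx'] at hflow ⊢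
    rw [show -x + -1 = -1 - x by ring]
    split_ifs at hflow ⊢ <;> linarith

lemma map_subLeft_Ico (l r : ℤ) :
    (Ico l r).map (Equiv.subLeft (-1)).toEmbedding = Ico (-r) (-l) := by
  ext x
  simp only [mem_map_equiv, Equiv.subLeft_symm_apply, mem_Ico]
  omega

end Erasure

/-- At a time when `E` is erased, the window `[q, q')` of `[l, r)` is erased in part, and no run of
`E` in `[l, r)` lies outside of the window. -/
structure Critical (E : Finset ℤ) (l r q q' : ℤ) : Prop where
  not_disjoint : ¬Disjoint E (Ico q q')
  not_subset : ¬Ico q q' ⊆ E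
  attached : Attached E l r q q'

lemma Critical.not_disjoint_of_le {E : Finset ℤ} {l r q q' x y : ℤ} (hE : Critical E l r q q')
    (hx : x ≤ q) (hy : q' ≤ y) : ¬Disjoint E (Ico x y) := fun hdisj =>
  hE.not_disjoint (hdisj.mono_right (Ico_subset_Ico hx hy))

lemma Attached.reverse {E : Finset ℤ} {l r q q' : ℤ} (hE : Attached E l r q q') :
    Attached (E.map (Equiv.subLeft (-1)).toEmbedding) (-r) (-l) (-q') (-q) := by
  constructor
  · rintro b hb hrb hbq x hx
    simp only [mem_map_equiv, Equiv.subLeft_symm_apply, mem_Ico] at hb hx ⊢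
    exact hE.2 _ hb (by omega) (by omega) (mem_Icc.2 (by omega))
  · rintro b hb hrb hbq x hx
    simp only [mem_map_equiv, Equiv.subLeft_symm_apply, mem_Icc] at hb hx ⊢
    exact hE.1 _ hb (by omega) (by omega) (mem_Ico.2 (by omega))

lemma Critical.reverse {E : Finset ℤ} {l r q q' : ℤ} (hE : Critical E l r q q') :
    Critical (E.map (Equiv.subLeft (-1)).toEmbedding) (-r) (-l) (-q') (-q) where
  not_disjoint := by
    rw [← Erasure.map_subLeft_Ico, disjoint_map]
    exact hE.not_disjoint
  not_subset := by
    rw [← Erasure.map_subLeft_Ico, map_subset_map]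
    exact hE.not_subset
  attached := hE.attached.reverse

namespace Erasure

variable {h : ℤ → ℤ} {P : Erasure h} {s₀ s₁ s₂ t : ℕ} {l r z x₁ y₁ x₂ y₂ W : ℤ}

lemma flow_lt_of_critical (hs₀ : s₀ ≤ s₁) (hz : z ≤ x₁) (hxy : x₁ ≤ y₁) (hyx : y₁ ≤ x₂)
    (hyr : y₂ ≤ r) (hdisj : Disjoint (P.erased s₀) (Ico z y₂))
    (hcrit : Critical (P.erased s₁) l r x₁ y₁) (hnot : ¬Ico x₂ y₂ ⊆ P.erased s₁)
    (hh : h y₁ = h x₁) (hflow : |P.flow s₁ y₁ - P.flow s₁ x₁| < W)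
    (hW : ∀ x ∈ Set.Icc y₁ y₂, h z + W ≤ h x) (hjoin : Ico z x₁ ⊆ P.erased s₁) :
    P.flow s₀ r < P.flow s₁ r := by
  obtain ⟨c, hc, hcE⟩ := not_subset.1 hnot
  rw [mem_Ico] at hc
  obtain ⟨y, hy₁y, hyc, hy, hyE⟩ := exists_Ico_subset_notMem (show y₁ ≤ c by omega) hcE
  have hempty : Disjoint (P.erased s₁) (Ico y r) := disjoint_left.2 fun b hb hbr => by
    have hne : y ≠ b := fun hyb => hyE (hyb ▸ hb)
    rw [mem_Ico] at hbr
    exact hyE (hcrit.attached.2 b hb (by omega) hbr.2 (mem_Icc.2 (by omega)))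
  have hempty₀ := hempty.mono_left (P.monotone_erased hs₀)
  have hzy := hdisj.mono_right (Ico_subset_Ico_right (show y ≤ y₂ by omega))
  have hW' := hW y ⟨hy₁y, by omega⟩
  have hflow' := (abs_lt.1 hflow).1
  calc P.flow s₀ r = P.flow s₀ y := flow_eq_of_disjoint (by omega) hempty₀
    _ = P.flow s₀ z := flow_eq_of_disjoint (by omega) hzy
    _ ≤ P.flow s₁ z := P.monotone_flow z hs₀
    _ < P.flow s₁ y := by
      linarith [flow_sub_flow_of_subset hz hjoin, flow_sub_flow_of_subset hy₁y hy]
    _ = P.flow s₁ r := (flow_eq_of_disjoint (by omega) hempty).symm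

/-- If a position to the left of the valley `z` is erased while the window `[x₁, y₁)` is critical,
then the run that joins it to the window carries a flow through `z`, which has to leave the tree
through `r` unless the run climbs across the second window. -/
lemma disjoint_of_critical_right (hs₀ : s₀ ≤ s₁) (hr : P.flow s₁ r = P.flow s₀ r)
    (hz : z ≤ x₁) (hxy : x₁ ≤ y₁) (hyx : y₁ ≤ x₂) (hyr : y₂ ≤ r)
    (hdisj : Disjoint (P.erased s₀) (Ico z y₂))
    (hcrit₁ : Critical (P.erased s₁) l r x₁ y₁) (hcrit₂ : Critical (P.erased s₂) l r x₂ y₂)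
    (hh : h y₁ = h x₁) (hflow : |P.flow s₁ y₁ - P.flow s₁ x₁| < W)
    (hW : ∀ x ∈ Set.Icc y₁ y₂, h z + W ≤ h x) (ht₁ : t ≤ s₁) (ht₂ : t ≤ s₂) :
    Disjoint (P.erased t) (Ico l z) := by
  refine disjoint_left.2 fun b hb hbz => ?_
  rw [mem_Ico] at hbz
  rcases le_total s₁ s₂ with hs | hs
  · have hjoin := hcrit₁.attached.1 b (P.monotone_erased ht₁ hb) hbz.1 (by omega)
    refine (flow_lt_of_critical hs₀ hz hxy hyx hyr hdisj hcrit₁ (fun hsub => ?_) hh hflow hW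
      ((Ico_subset_Ico_left hbz.2.le).trans hjoin)).ne' hr
    exact hcrit₂.not_subset (hsub.trans (P.monotone_erased hs))
  · have hjoin := hcrit₂.attached.1 b (P.monotone_erased ht₂ hb) hbz.1 (by omega)
    exact hcrit₁.not_subset
      ((Ico_subset_Ico (by omega) hyx).trans (hjoin.trans (P.monotone_erased hs)))

lemma disjoint_of_critical_left (hs₀ : s₀ ≤ s₂) (hl : P.flow s₂ l = P.flow s₀ l)
    (hlx : l ≤ x₁) (hyx : y₁ ≤ x₂) (hxy : x₂ ≤ y₂) (hz : y₂ ≤ z)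
    (hdisj : Disjoint (P.erased s₀) (Ico x₁ z))
    (hcrit₁ : Critical (P.erased s₁) l r x₁ y₁) (hcrit₂ : Critical (P.erased s₂) l r x₂ y₂)
    (hh : h y₂ = h x₂) (hflow : |P.flow s₂ y₂ - P.flow s₂ x₂| < W)
    (hW : ∀ x ∈ Set.Icc x₁ x₂, h z + W ≤ h x) (ht₁ : t ≤ s₁) (ht₂ : t ≤ s₂) :
    Disjoint (P.erased t) (Ico z r) := by
  have hdisj' := (disjoint_map (Equiv.subLeft (-1 : ℤ)).toEmbedding).2 hdisj
  rw [← disjoint_map (Equiv.subLeft (-1 : ℤ)).toEmbedding, map_subLeft_Ico]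
  rw [map_subLeft_Ico] at hdisj'
  refine P.reverse.disjoint_of_critical_right (z := -z) hs₀ (by simpa [reverse] using hl)
    (by omega) (by omega) (by omega) (by omega) hdisj' hcrit₂.reverse hcrit₁.reverse
    (by simpa using hh.symm) (by simpa [reverse, abs_sub_comm] using hflow) ?_ ht₂ ht₁
  rintro x ⟨hxl, hxr⟩
  simpa using hW (-x) ⟨by omega, by omega⟩

end Erasure

lemma exists_active_period {α : Type*} {E : ℕ → Finset α} (hE : Monotone E)
    {I : Finset α} (hI : I.Nonempty) {s t : ℕ} (hs : Disjoint (E s) I) (ht : I ⊆ E t) :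
    ∃ u v, s ≤ u ∧ u ≤ v ∧ v ≤ t ∧ Disjoint (E u) I ∧ I ⊆ E v ∧
      ∀ τ, u ≤ τ → τ < v → ¬Disjoint (E (τ + 1)) I ∧ ¬I ⊆ E τ := by
  classical
  have hsep : ∀ {u v}, Disjoint (E u) I → I ⊆ E v → u < v := fun hu hv => by
    by_contra! hvu
    exact hI.ne_empty (disjoint_self.1 (hu.mono_left (hv.trans (hE hvu))))
  have hst := (hsep hs ht).le
  have hex : ∃ v, I ⊆ E v := ⟨t, ht⟩
  have hvt : Nat.find hex ≤ t := Nat.find_min' hex ht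
  have hu := Nat.findGreatest_spec (P := fun u => Disjoint (E u) I) hst hs
  refine ⟨_, Nat.find hex, Nat.le_findGreatest hst hs, (hsep hu (Nat.find_spec hex)).le, hvt, hu,
    Nat.find_spec hex, fun τ huτ hτv => ⟨?_, Nat.find_min hex hτv⟩⟩
  exact Nat.findGreatest_is_greatest (Nat.lt_succ_of_le huτ) (by omega)

lemma card_jumps_le {g : ℕ → ℤ} (hg : Monotone g) {s t : ℕ} (hst : s ≤ t) :
    #{τ ∈ Ico s t | g τ ≠ g (τ + 1)} ≤ g t - g s := by
  rw [card_filter, ← sum_Ico_sub g hst]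
  push_cast
  refine sum_le_sum fun τ _ => ?_
  have hle : g τ ≤ g (τ + 1) := hg τ.le_succ
  split_ifs <;> omega

namespace Occurs

lemma exists_two_copies {h : ℤ → ℤ} {p : ℤ} {L e : ℕ} {a : ℕ → ℕ} (ha : ∀ i, 0 < a i)
    (hp : Occurs h (X a (L + e + 1)).toList p) :
    ∃ q q', Occurs h (X a L).toList q ∧ Occurs h (X a L).toList q' ∧ p ≤ q ∧ q + len a L ≤ q' ∧
      q' + len a L ≤ p + len a (L + e + 1) ∧
      ∀ x ∈ Set.Icc q (q' + len a L), h p + a (L + e + 1) ≤ h x := by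
  have hcopy : ∀ {p}, Occurs h (X a (L + e)).toList p → ∃ q, Occurs h (X a L).toList q ∧ p ≤ q ∧
      q + len a L ≤ p + len a (L + e) := fun hp => by
    obtain ⟨Q, hQcard, -, hQ⟩ := hp.exists_copies ha
    obtain ⟨q, hq⟩ := card_pos.1 (hQcard ▸ Nat.two_pow_pos e)
    exact ⟨q, hQ q hq⟩
  obtain ⟨q, hq, hpq, hq'⟩ := hcopy hp.fst
  obtain ⟨q', hq'', hpq', hq'''⟩ := hcopy hp.snd
  have hlen : (len a (L + e + 1) : ℤ) = 2 * len a (L + e) + 2 * a (L + e + 1) :=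
    mod_cast len_succ a (L + e)
  have hinner : ((X a (L + e) + X a (L + e)).toList.length : ℤ) = 2 * len a (L + e) := by
    have happend : (X a (L + e) + X a (L + e)).toList.length = len a (L + e) + len a (L + e) :=
      List.length_append
    omega
  rw [← len] at hpq'
  rw [← len] at hq'''
  refine ⟨q, q', hq, hq'', by omega, by omega, by omega, fun x hx => ?_⟩
  rw [← hp.height_of_frame]
  have := hx.1
  have := hx.2
  exact hp.of_frame.le (by omega) (by omega)

end Occurs

/-- Between the times `s` and `t` all of `I` is erased, and no pair is formed that straddles the
cut at `l` or the cut at `r`. -/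
structure Erasure.QuietlyErases {h : ℤ → ℤ} (P : Erasure h) (l r : ℤ) (I : Finset ℤ)
    (s t : ℕ) : Prop where
  flow_left : P.flow t l = P.flow s l
  flow_right : P.flow t r = P.flow s r
  disjoint : Disjoint (P.erased s) I
  subset : I ⊆ P.erased t

namespace Erasure

variable {h : ℤ → ℤ} {P : Erasure h} {a : ℕ → ℕ} {d e w H s t : ℕ} {l r p n : ℤ}

lemma flow_eq_of_mem_Icc {x : ℤ} {u : ℕ} (hst : P.flow t x = P.flow s x) (hu : u ∈ Set.Icc s t) :
    P.flow u x = P.flow s x :=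
  le_antisymm (hst ▸ P.monotone_flow x hu.2) (P.monotone_flow x hu.1)

lemma abs_flow_sub_flow_le_of_occurs {L : ℕ} (hruns : runs (P.erased t) ≤ w)
    (hp : Occurs h (X a L).toList p) :
    |P.flow t (p + len a L) - P.flow t p| ≤ (w * ∑ i ∈ range (L + 1), a i : ℕ) := by
  refine (P.abs_flow_sub_flow_le t (lo := h p) (H := (∑ i ∈ range (L + 1), a i : ℕ)) (by omega)
    fun x hx => ⟨hp.le hx.1 hx.2, ?_⟩).trans ?_
  · exact_mod_cast hp.height_sub_le hx.1 hx.2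
  · rw [← Nat.cast_mul, Nat.cast_le]
    exact Nat.mul_le_mul_right _ ((runs_inter_Ico_le _ _ _).trans hruns)

lemma exists_not_critical {L : ℕ} (ha : ∀ i, 0 < a i) (hruns : ∀ t, runs (P.erased t) ≤ w)
    (hW : w * ∑ i ∈ range (L + 1), a i < a (L + e + 1))
    (hp : Occurs h (X a (L + e + 2)).toList p) (hlp : l ≤ p) (hpr : p + len a (L + e + 2) ≤ r)
    (hquiet : P.QuietlyErases l r (Ico p (p + len a (L + e + 2))) s t) :
    ∃ q, Occurs h (X a L).toList q ∧ p ≤ q ∧ q + len a L ≤ p + len a (L + e + 2) ∧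
      ∀ u ∈ Set.Icc s t, ¬Critical (P.erased u) l r q (q + len a L) := by
  have hlen : (len a (L + e + 2) : ℤ) = 2 * len a (L + e + 1) + 2 * a (L + e + 2) :=
    mod_cast len_succ a (L + e + 1)
  have hflow : ∀ u {q}, Occurs h (X a L).toList q →
      |P.flow u (q + len a L) - P.flow u q| < (a (L + e + 1) : ℤ) := fun u q hq =>
    (abs_flow_sub_flow_le_of_occurs (hruns u) hq).trans_lt (by exact_mod_cast hW)
  set z := p + a (L + e + 2) + len a (L + e + 1)
  have hfst : Occurs h (X a (L + e + 1)).toList (p + a (L + e + 2)) := hp.fst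
  have hsnd : Occurs h (X a (L + e + 1)).toList z := hp.snd
  have hvalley : h z = h (p + a (L + e + 2)) := hfst.height_end
  obtain ⟨q₁, q₂, hq₁, hq₂, hpq₁, hq₁₂, hq₂z, hW₁₂⟩ := hfst.exists_two_copies ha
  obtain ⟨q₃, q₄, hq₃, hq₄, hzq₃, hq₃₄, hq₄p, hW₃₄⟩ := hsnd.exists_two_copies ha
  by_contra! hcon
  obtain ⟨u₁, -, hcrit₁⟩ := hcon q₁ hq₁ (by omega) (by omega)
  obtain ⟨u₂, hu₂, hcrit₂⟩ := hcon q₂ hq₂ (by omega) (by omega)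
  obtain ⟨u₃, hu₃, hcrit₃⟩ := hcon q₃ hq₃ (by omega) (by omega)
  obtain ⟨u₄, -, hcrit₄⟩ := hcon q₄ hq₄ (by omega) (by omega)
  have hleft : ∀ u ≤ u₃, u ≤ u₄ → Disjoint (P.erased u) (Ico l z) := fun u =>
    disjoint_of_critical_right hu₃.1 (flow_eq_of_mem_Icc hquiet.flow_right hu₃) hzq₃ (by omega)
      hq₃₄ (by omega) (hquiet.disjoint.mono_right (Ico_subset_Ico (by omega) (by omega))) hcrit₃
      hcrit₄ hq₃.height_end (hflow _ hq₃) fun x hx => hW₃₄ x ⟨by have := hx.1; omega, hx.2⟩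
  have hright : ∀ u ≤ u₁, u ≤ u₂ → Disjoint (P.erased u) (Ico z r) := fun u =>
    disjoint_of_critical_left hu₂.1 (flow_eq_of_mem_Icc hquiet.flow_left hu₂) (by omega) hq₁₂
      (by omega) (by omega) (hquiet.disjoint.mono_right (Ico_subset_Ico (by omega) (by omega)))
      hcrit₁ hcrit₂ hq₂.height_end (hflow _ hq₂) fun x hx => by
        rw [hvalley]
        exact hW₁₂ x ⟨hx.1, by have := hx.2; omega⟩
  have hlt₁ : ¬(u₁ ≤ u₃ ∧ u₁ ≤ u₄) := fun hu =>
    hcrit₁.not_disjoint_of_le (by omega) (by omega) (hleft u₁ hu.1 hu.2)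
  have hlt₂ : ¬(u₂ ≤ u₃ ∧ u₂ ≤ u₄) := fun hu =>
    hcrit₂.not_disjoint_of_le (by omega) (by omega) (hleft u₂ hu.1 hu.2)
  have hlt₃ : ¬(u₃ ≤ u₁ ∧ u₃ ≤ u₂) := fun hu =>
    hcrit₃.not_disjoint_of_le (by omega) (by omega) (hright u₃ hu.1 hu.2)
  have hlt₄ : ¬(u₄ ≤ u₁ ∧ u₄ ≤ u₂) := fun hu =>
    hcrit₄.not_disjoint_of_le (by omega) (by omega) (hright u₄ hu.1 hu.2)
  omega

lemma exists_quietlyErases {Q : Finset ℤ} (hn : 0 < n) (hst : s ≤ t)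
    (hQ : (Q : Set ℤ).PairwiseDisjoint fun q => Ico q (q + n))
    (hdisj : ∀ q ∈ Q, Disjoint (P.erased s) (Ico q (q + n)))
    (hsub : ∀ q ∈ Q, Ico q (q + n) ⊆ P.erased t)
    (hH : ∀ x, h x ≤ H) (hruns : ∀ t, runs (P.erased t) ≤ w) (hcard : 2 * H * (2 * w + 2) < #Q) :
    ∃ q ∈ Q, ∃ u v, s ≤ u ∧ u ≤ v ∧ v ≤ t ∧ P.QuietlyErases l r (Ico q (q + n)) u v := by
  set g : ℕ → ℤ := fun τ => P.flow τ l + P.flow τ r with hg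
  have hmono : Monotone g := (P.monotone_flow l).add (P.monotone_flow r)
  set S : Finset ℕ := {τ ∈ Ico s t | g τ ≠ g (τ + 1)}
  set active : ℕ → Finset ℤ := fun τ => {q ∈ Q | ¬Disjoint (P.erased (τ + 1)) (Ico q (q + n)) ∧
    ¬Ico q (q + n) ⊆ P.erased τ}
  have hScard : #S ≤ 2 * H := by
    have hjumps : (#S : ℤ) ≤ g t - g s := card_jumps_le hmono hst
    have := P.flow_nonneg s l
    have := P.flow_nonneg s r
    have := (P.flow_le t l).trans (hH l)
    have := (P.flow_le t r).trans (hH r)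
    simp only [hg] at hjumps
    omega
  obtain ⟨q, hq, hqS⟩ : ∃ q ∈ Q, q ∉ S.biUnion active := by
    refine not_subset.1 fun hQS => hcard.not_ge ?_
    calc #Q ≤ #S * (2 * w + 2) := (card_le_card hQS).trans (card_biUnion_le_card_mul _ _ _ ?_)
      _ ≤ 2 * H * (2 * w + 2) := Nat.mul_le_mul_right _ hScard
    exact fun τ _ => (card_cut_windows_le hQ _ _).trans
      (add_le_add (Nat.mul_le_mul_left 2 (hruns τ)) (P.card_sdiff_le τ))
  obtain ⟨u, v, hsu, huv, hvt, hu, hv, huvactive⟩ := exists_active_period P.monotone_erased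
    (nonempty_Ico.2 (by omega)) (hdisj q hq) (hsub q hq)
  have hconst : ∀ τ, u ≤ τ → τ ≤ v → g τ = g u := fun τ huτ => by
    induction τ, huτ using Nat.le_induction with
    | base => exact fun _ => rfl
    | succ τ huτ ih =>
      refine fun hτv => Eq.trans (by_contra fun hne => hqS ?_) (ih (by omega))
      exact mem_biUnion.2 ⟨τ, mem_filter.2 ⟨mem_Ico.2 (by omega), Ne.symm hne⟩,
        mem_filter.2 ⟨hq, huvactive τ huτ hτv⟩⟩
  have hguv := hconst v huv le_rfl
  have hl : P.flow u l ≤ P.flow v l := P.monotone_flow l huv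
  have hr : P.flow u r ≤ P.flow v r := P.monotone_flow r huv
  simp only [hg] at hguv
  exact ⟨q, hq, u, v, hsu, huv, hvt, by omega, by omega, hu, hv⟩

end Erasure

lemma runs_inter_Ico_lt_of_not_critical {E : Finset ℤ} {l r q q' : ℤ} (hl : l ≤ q) (hr : q' ≤ r)
    (hpos : 0 < runs (E ∩ Ico q q')) (hsub : ¬Ico q q' ⊆ E) (hcrit : ¬Critical E l r q q') :
    runs (E ∩ Ico q q') < runs (E ∩ Ico l r) := by
  have hdisj : ¬Disjoint E (Ico q q') := fun hdisj => by
    simp [disjoint_iff_inter_eq_empty.1 hdisj, runs] at hpos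
  have hqq' : q ≤ q' := by
    by_contra! hlt
    exact hdisj (by simp [Ico_eq_empty_of_le hlt.le])
  by_contra! hle
  exact hcrit ⟨hdisj, hsub, attached_of_runs_le hl hr hqq' hle⟩

namespace Erasure

variable {h : ℤ → ℤ} {P : Erasure h} {a : ℕ → ℕ} {d e w H top : ℕ}

lemma exists_partly_erased {E : ℕ → Finset ℤ} (hE : Monotone E)
    (hcard : ∀ t, #(E (t + 1) \ E t) ≤ 2) {I : Finset ℤ} (hI : 2 < #I) {s t : ℕ}
    (hs : Disjoint (E s) I) (ht : I ⊆ E t) :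
    ∃ u ∈ Set.Icc s t, ¬Disjoint (E u) I ∧ ¬I ⊆ E u := by
  obtain ⟨u, v, hsu, huv, hvt, hu, hv, hactive⟩ :=
    exists_active_period hE (card_pos.1 (by omega)) hs ht
  have hne : u ≠ v := by
    rintro rfl
    have := card_eq_zero.2 (disjoint_self.1 (hu.mono_left hv))
    omega
  refine ⟨u + 1, ⟨by omega, by omega⟩, (hactive u le_rfl (by omega)).1, fun hsub => ?_⟩
  exact (hcard u).not_gt (hI.trans_le (card_le_card (subset_sdiff.2 ⟨hsub, hu.symm⟩)))

/-- Each level of the recursion finds, inside of a quietly erased copy, a smaller copy that is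
erased quietly and without becoming critical, so that at all times a run lies outside of it. -/
theorem exists_lt_runs (ha : ∀ i, 0 < a i) (hH : ∀ x, h x ≤ H) (hruns : ∀ t, runs (P.erased t) ≤ w)
    (hW : ∀ M, M + e + 2 ≤ top → w * ∑ i ∈ range (M + 1), a i < a (M + e + 1))
    (hd : 2 * H * (2 * w + 2) < 2 ^ d) (k : ℕ) :
    ∀ {L : ℕ} {l r p : ℤ} {s t : ℕ}, k * (e + 2 + d) + 1 ≤ L → L ≤ top →
      Occurs h (X a L).toList p → l ≤ p → p + len a L ≤ r → s ≤ t →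
      P.QuietlyErases l r (Ico p (p + len a L)) s t →
      ∃ u ∈ Set.Icc s t, k < runs (P.erased u ∩ Ico l r) ∧ ¬Ico p (p + len a L) ⊆ P.erased u := by
  induction k with
  | zero =>
    intro L l r p s t hL _ _ hlp hpr _ hquiet
    have hlen : 2 ^ 2 ≤ len a L :=
      (Nat.pow_le_pow_right two_pos (by omega)).trans (two_pow_le_len ha L)
    obtain ⟨u, hu, hmeet, hnot⟩ := exists_partly_erased P.monotone_erased P.card_sdiff_le
      (by rw [Int.card_Ico]; omega) hquiet.disjoint hquiet.subset
    refine ⟨u, hu, runs_pos ?_, hnot⟩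
    rw [← not_disjoint_iff_nonempty_inter]
    exact fun hdisj => hmeet (hdisj.mono_right (Ico_subset_Ico hlp hpr))
  | succ k ih =>
    intro L l r p s t hL htop hp hlp hpr hst hquiet
    obtain ⟨L', rfl⟩ : ∃ L', L = L' + d + e + 2 :=
      ⟨L - d - e - 2, by rw [add_mul] at hL; omega⟩
    obtain ⟨q, hq, hpq, hqp, hnot⟩ := exists_not_critical ha hruns (hW _ htop) hp hlp hpr hquiet
    obtain ⟨Q, hQcard, hQdisj, hQ⟩ := hq.exists_copies ha
    have hsub : ∀ c ∈ Q, Ico c (c + len a L') ⊆ Ico p (p + len a (L' + d + e + 2)) := fun c hc =>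
      Ico_subset_Ico (hpq.trans (hQ c hc).2.1) ((hQ c hc).2.2.trans hqp)
    obtain ⟨c, hc, s', t', hss', hst', htt', hquiet'⟩ := exists_quietlyErases
      (l := q) (r := q + len a (L' + d)) (by exact_mod_cast len_pos ha L') hst hQdisj
      (fun c hc => hquiet.disjoint.mono_right (hsub c hc))
      (fun c hc => (hsub c hc).trans hquiet.subset) hH hruns (hQcard ▸ hd)
    obtain ⟨hcopy, hqc, hcq⟩ := hQ c hc
    obtain ⟨u, hu, hk, hnot'⟩ := ih (L := L') (by rw [add_mul] at hL; omega) (by omega) hcopy hqc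
      hcq hst' hquiet'
    have hu' : u ∈ Set.Icc s t := ⟨hss'.trans hu.1, hu.2.trans htt'⟩
    refine ⟨u, hu', (Nat.succ_le_of_lt hk).trans_lt ?_, fun hall => hnot' ((hsub c hc).trans hall)⟩
    exact runs_inter_Ico_lt_of_not_critical (by omega) (by omega) (by omega)
      (fun hall => hnot' ((Ico_subset_Ico hqc hcq).trans hall)) (hnot u hu')

end Erasure

namespace RePairing

variable {σ : DyckWord} (p : RePairing σ)

/-- The positions of the `i`-th pair of a re-pairing. -/
def pair (i : Fin (σ.toList.length / 2)) : Finset ℤ :=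
  {((p.left i : ℕ) : ℤ), ((p.right i : ℕ) : ℤ)}

/-- The set `p.erased t` as a `Finset`. -/
def erasedFinset (t : ℕ) : Finset ℤ :=
  ({i | i < t} : Finset (Fin (σ.toList.length / 2))).biUnion p.pair

/-- The number of the first `t` pairs that straddle the cut to the left of the position `x`. -/
def flow (t : ℕ) (x : ℤ) : ℤ :=
  ∑ i with i.val < t, if (p.left i : ℕ) < x ∧ x ≤ (p.right i : ℕ) then 1 else 0

lemma coe_erasedFinset (t : ℕ) : (p.erasedFinset t : Set ℤ) = p.erased t := by
  ext b
  simp [erasedFinset, pair, erased]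

lemma setWidth_erased_le (t : ℕ) : setWidth (p.erased t) ≤ p.width := by
  have hmin : p.erased t = p.erased (min t (σ.toList.length / 2)) := by
    ext b
    refine exists_congr fun i => and_congr_left fun _ => ?_
    omega
  rw [hmin]
  exact le_sup (f := fun t => setWidth (p.erased t)) (mem_range.2 (by omega))

lemma exists_mem_pair_iff {x : ℤ} : (∃ i, x ∈ p.pair i) ↔ 0 ≤ x ∧ x < σ.toList.length := by
  simp only [pair, mem_insert, mem_singleton]
  constructor
  · rintro ⟨i, hi⟩
    omega
  · rintro ⟨hx, hx'⟩
    obtain ⟨i, hi, -⟩ := p.exactly_one ⟨x.toNat, by omega⟩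
    simp only [Fin.ext_iff] at hi
    exact ⟨i, by omega⟩

lemma pairwise_disjoint_pair : Pairwise (Function.onFun Disjoint p.pair) := by
  refine fun i j hij => disjoint_left.2 fun b hbi hbj => hij ?_
  obtain ⟨hb, hb'⟩ := p.exists_mem_pair_iff.1 ⟨i, hbi⟩
  simp only [pair, mem_insert, mem_singleton] at hbi hbj
  refine (p.exactly_one ⟨b.toNat, by omega⟩).unique ?_ ?_ <;> simp only [Fin.ext_iff] <;> omega

lemma crossing_add_one (i : Fin (σ.toList.length / 2)) (x : ℤ) :
    (if (p.left i : ℕ) < x + 1 ∧ x + 1 ≤ (p.right i : ℕ) then 1 else 0 : ℤ) =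
      (if (p.left i : ℕ) < x ∧ x ≤ (p.right i : ℕ) then 1 else 0) +
        if x ∈ p.pair i then height σ.toList (x + 1) - height σ.toList x else 0 := by
  have hlt : (p.left i : ℕ) < p.right i := p.left_lt_right i
  have hleft := height_add_one σ.toList (p.left i)
  have hright := height_add_one σ.toList (p.right i)
  rw [p.left_open i, if_pos rfl] at hleft
  rw [p.right_close i, if_neg DyckStep.noConfusion] at hright
  by_cases hxl : x = (p.left i : ℕ)
  · rw [hxl, hleft, if_pos (by omega), if_neg (by omega), if_pos (by simp [pair])]
    ring
  by_cases hxr : x = (p.right i : ℕ)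
  · rw [hxr, hright, if_neg (by omega), if_pos (by omega), if_pos (by simp [pair])]
    ring
  rw [if_neg (by simp [pair, hxl, hxr] : x ∉ p.pair i), add_zero]
  exact if_congr (by omega) rfl rfl

lemma flow_add_one (t : ℕ) (x : ℤ) : p.flow t (x + 1) =
    p.flow t x +
      if x ∈ p.erasedFinset t then height σ.toList (x + 1) - height σ.toList x else 0 := by
  simp only [flow, p.crossing_add_one, sum_add_distrib, add_right_inj]
  have hsum := sum_biUnion (s := {i | i.val < t})
    (f := fun b => if b = x then height σ.toList (x + 1) - height σ.toList x else 0)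
    (p.pairwise_disjoint_pair.set_pairwise _)
  simp only [sum_ite_eq'] at hsum
  exact hsum.symm.trans (if_congr Iff.rfl rfl rfl)

lemma monotone_flow (x : ℤ) : Monotone fun t => p.flow t x := fun s t hst =>
  sum_le_sum_of_subset_of_nonneg (monotone_filter_right _ fun _ _ hi => hi.trans_le hst)
    fun i _ _ => by split_ifs <;> simp

lemma flow_end (x : ℤ) : p.flow (σ.toList.length / 2) x = height σ.toList x := by
  rcases le_total x 0 with hx | hx
  · rw [height_of_nonpos _ hx]
    exact sum_eq_zero fun i _ => if_neg (by omega)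
  induction x, hx using Int.leInduction with
  | base =>
    rw [height_of_nonpos _ le_rfl]
    exact sum_eq_zero fun i _ => if_neg (by omega)
  | succ x hx ih =>
    rw [p.flow_add_one, ih]
    split_ifs with hmem
    · ring
    · have hx' : σ.toList.length ≤ x := by
        by_contra! hlt
        obtain ⟨i, hi⟩ := p.exists_mem_pair_iff.2 ⟨hx, hlt⟩
        exact hmem (mem_biUnion.2 ⟨i, by simp, hi⟩)
      rw [add_zero, height_of_length_le _ hx', height_of_length_le _ (x := x + 1) (by omega)]

lemma card_erasedFinset_sdiff_le (t : ℕ) :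
    #(p.erasedFinset (t + 1) \ p.erasedFinset t) ≤ 2 := by
  have hsub : p.erasedFinset (t + 1) \ p.erasedFinset t ⊆
      ({i | i.val = t} : Finset (Fin (σ.toList.length / 2))).biUnion p.pair := fun b hb => by
    simp only [erasedFinset, mem_sdiff, mem_biUnion, mem_filter_univ] at hb ⊢
    obtain ⟨⟨i, hi, hbi⟩, hnot⟩ := hb
    exact ⟨i, le_antisymm (Nat.le_of_lt_succ hi) (not_lt.1 fun hlt => hnot ⟨i, hlt, hbi⟩), hbi⟩
  have hpair : ∀ i, #(p.pair i) ≤ 2 := fun i => card_le_two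
  refine (card_le_card hsub).trans ((card_biUnion_le_card_mul _ _ 2 fun i _ => hpair i).trans ?_)
  refine Nat.mul_le_mul_right 2 (card_le_one.2 fun i hi j hj => Fin.ext ?_)
  rw [(mem_filter_univ i).1 hi, (mem_filter_univ j).1 hj]

/-- The erasure of the positions of a Dyck word by the pairs of a re-pairing. -/
def toErasure : Erasure (height σ.toList) where
  erased := p.erasedFinset
  flow := p.flow
  monotone_erased _ _ hst := biUnion_subset_biUnion_of_subset_left _
    (monotone_filter_right _ fun _ _ hi => hi.trans_le hst)
  card_sdiff_le := p.card_erasedFinset_sdiff_le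
  monotone_flow := p.monotone_flow
  flow_nonneg t x := sum_nonneg fun i _ => by split_ifs <;> simp
  flow_le t x := by
    rw [← p.flow_end]
    rcases le_total t (σ.toList.length / 2) with ht | ht
    · exact p.monotone_flow x ht
    · exact (sum_congr (filter_congr fun i _ => by omega) fun _ _ => rfl).le
  flow_add_one := p.flow_add_one

lemma runs_erasedFinset_le (t : ℕ) : runs (p.erasedFinset t) ≤ p.width :=
  (runs_le_setWidth _).trans (p.coe_erasedFinset t ▸ p.setWidth_erased_le t)

lemma toErasure_quietlyErases :
    p.toErasure.QuietlyErases 0 σ.toList.length (Ico 0 (σ.toList.length : ℤ)) 0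
      (σ.toList.length / 2) := by
  have hflow : ∀ {x}, height σ.toList x = 0 → ∀ t, p.toErasure.flow t x = 0 := fun {x} hx t =>
    le_antisymm (hx ▸ p.toErasure.flow_le t x) (p.toErasure.flow_nonneg t x)
  refine ⟨?_, ?_, ?_, fun x hx => ?_⟩
  · rw [hflow (height_of_nonpos _ le_rfl), hflow (height_of_nonpos _ le_rfl)]
  · rw [hflow (height_length σ), hflow (height_length σ)]
  · simp [toErasure, erasedFinset]
  · obtain ⟨i, hi⟩ := p.exists_mem_pair_iff.2 (mem_Ico.1 hx)
    exact mem_biUnion.2 ⟨i, by simp, hi⟩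

end RePairing

lemma orderEmbOfFin_le_of_card_filter_le {α : Type*} [LinearOrder α] {A B : Finset α} {k : ℕ}
    (hA : #A = k) (hB : #B = k) (hAB : ∀ x, #{b ∈ B | b ≤ x} ≤ #{a ∈ A | a ≤ x}) (i : Fin k) :
    A.orderEmbOfFin hA i ≤ B.orderEmbOfFin hB i := by
  by_contra! hlt
  have hB' : (Iic i).map (B.orderEmbOfFin hB).toEmbedding ⊆
      {b ∈ B | b ≤ B.orderEmbOfFin hB i} := fun b hb => by
    obtain ⟨j, hj, rfl⟩ := mem_map.1 hb
    exact mem_filter.2 ⟨B.orderEmbOfFin_mem hB j, (B.orderEmbOfFin hB).monotone (mem_Iic.1 hj)⟩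
  have hA' : {a ∈ A | a ≤ B.orderEmbOfFin hB i} ⊆
      (Iio i).map (A.orderEmbOfFin hA).toEmbedding := fun a ha => by
    obtain ⟨haA, hai⟩ := mem_filter.1 ha
    obtain ⟨j, rfl⟩ : a ∈ Set.range (A.orderEmbOfFin hA) := by simpa using haA
    have hji := (A.orderEmbOfFin hA).lt_iff_lt.1 (hai.trans_lt hlt)
    exact mem_map_of_mem _ (mem_Iio.2 hji)
  have hcard := (card_le_card hB').trans ((hAB _).trans (card_le_card hA'))
  simp only [card_map, Fin.card_Iic, Fin.card_Iio] at hcard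
  omega

/-- The positions of the letter `c` in the word `u`. -/
def positions (u : List DyckStep) (c : DyckStep) : Finset (Fin u.length) := {i | u.get i = c}

lemma mem_positions {u : List DyckStep} {c : DyckStep} {i : Fin u.length} :
    i ∈ positions u c ↔ u.get i = c :=
  mem_filter_univ i

lemma card_positions_filter_lt (u : List DyckStep) (c : DyckStep) (n : ℕ) :
    #{i ∈ positions u c | i.val < n} = (u.take n).count c := by
  rw [positions, filter_filter]
  induction u generalizing n with
  | nil => simp
  | cons b u ih =>
    cases n with
    | zero => simp
    | succ n =>
      simp only [List.length_cons, Fin.card_filter_univ_succ, List.take_succ_cons, List.count_cons,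
        ← ih]
      by_cases hb : b = c <;> simp [hb]

lemma card_positions (σ : DyckWord) (c : DyckStep) :
    #(positions σ.toList c) = σ.toList.length / 2 := by
  have hcount : #(positions σ.toList c) = σ.toList.count c := by
    have := card_positions_filter_lt σ.toList c σ.toList.length
    rwa [List.take_length, filter_true_of_mem fun i _ => i.2] at this
  rw [hcount, ← σ.two_mul_semilength_eq_length, Nat.mul_div_cancel_left _ two_pos]
  cases c with
  | U => rfl
  | D => exact σ.semilength_eq_count_D.symm

/-- The `i`-th opening bracket is paired with the `i`-th closing one. -/
instance (σ : DyckWord) : Nonempty (RePairing σ) := by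
  have hU := card_positions σ .U
  have hD := card_positions σ .D
  have hle := orderEmbOfFin_le_of_card_filter_le hU hD fun x => by
    have hcount := σ.count_D_le_count_U (x + 1)
    rw [← card_positions_filter_lt, ← card_positions_filter_lt] at hcount
    simpa only [Fin.le_def, Nat.lt_succ_iff] using hcount
  have hopen := fun i => mem_positions.1 (orderEmbOfFin_mem _ hU i)
  have hclose := fun i => mem_positions.1 (orderEmbOfFin_mem _ hD i)
  have hne : ∀ i j, orderEmbOfFin _ hU i ≠ orderEmbOfFin _ hD j := fun i j heq => by
    have := hopen i
    rw [heq, hclose j] at this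
    exact DyckStep.noConfusion this
  refine ⟨⟨_, _, hopen, hclose, fun i => (hle i).lt_of_ne (hne i i), fun b => ?_⟩⟩
  rcases hb : σ.toList.get b with _ | _
  · obtain ⟨i, rfl⟩ : b ∈ Set.range (orderEmbOfFin _ hU) := by simpa using mem_positions.2 hb
    refine ⟨i, .inl rfl, ?_⟩
    rintro j (hj | hj)
    · exact (orderEmbOfFin _ hU).injective hj.symm
    · exact absurd hj (hne i j)
  · obtain ⟨i, rfl⟩ : b ∈ Set.range (orderEmbOfFin _ hD) := by simpa using mem_positions.2 hb
    refine ⟨i, .inr rfl, ?_⟩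
    rintro j (hj | hj)
    · exact absurd hj.symm (hne j i)
    · exact (orderEmbOfFin _ hD).injective hj.symm

theorem min_lt_width_X {a : ℕ → ℕ} (ha : ∀ i, 0 < a i) {w d e L k : ℕ}
    (hW : ∀ M, M + e + 2 ≤ L → w * ∑ i ∈ range (M + 1), a i < a (M + e + 1))
    (hd : 2 * (∑ i ∈ range (L + 1), a i) * (2 * w + 2) < 2 ^ d) (hk : k * (e + 2 + d) + 1 ≤ L) :
    min w k < width (X a L) := by
  obtain ⟨p, hp⟩ : ∃ p : RePairing (X a L), p.width = width (X a L) :=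
    Nat.sInf_mem (Set.range_nonempty fun p : RePairing (X a L) => p.width)
  by_contra! hle
  rw [← hp, le_min_iff] at hle
  have hquiet : p.toErasure.QuietlyErases 0 (0 + len a L) (Ico 0 (0 + len a L)) 0
      ((X a L).toList.length / 2) := by
    rw [zero_add]
    exact p.toErasure_quietlyErases
  have hheight : ∀ x, height (X a L).toList x ≤ (∑ i ∈ range (L + 1), a i : ℕ) := fun x => by
    exact_mod_cast height_X_le a L x
  have hruns : ∀ t, runs (p.toErasure.erased t) ≤ w := fun t =>
    (p.runs_erasedFinset_le t).trans hle.1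
  obtain ⟨u, -, hu, -⟩ := Erasure.exists_lt_runs ha hheight hruns hW hd k hk le_rfl
    (Occurs.height_self _) le_rfl le_rfl (Nat.zero_le _) hquiet
  exact hu.not_ge ((runs_inter_Ico_le _ _ _).trans ((p.runs_erasedFinset_le u).trans hle.2))

lemma sum_two_pow_div_le (ℓ q : ℕ) : ∑ i ∈ range (ℓ * q), 2 ^ (i / ℓ) ≤ ℓ * 2 ^ q := by
  induction q with
  | zero => simp
  | succ q ih =>
    have hblock : ∑ i ∈ range ℓ, 2 ^ ((ℓ * q + i) / ℓ) = ℓ * 2 ^ q := by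
      have hdiv : ∀ i ∈ range ℓ, 2 ^ ((ℓ * q + i) / ℓ) = 2 ^ q := fun i hi => by
        have hi := mem_range.1 hi
        rw [Nat.mul_add_div (by omega), Nat.div_eq_of_lt hi, add_zero]
      rw [sum_congr rfl hdiv, sum_const, card_range, smul_eq_mul]
    rw [Nat.mul_succ, sum_range_add, hblock, pow_succ]
    linarith

lemma min_lt_width_Y₂ {m ℓ g k : ℕ} (hg : ℓ < 2 ^ (g + 1))
    (hk : k * (ℓ * (2 * g + 3) + m + 2 * g + 7) + 2 ≤ m * ℓ) : min ℓ k < width (Y₂ m ℓ) := by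
  have hsq : ℓ * ℓ < 2 ^ (2 * g + 2) := by
    convert Nat.mul_lt_mul'' hg hg using 1
    ring
  have hℓ : 0 < ℓ := Nat.pos_of_ne_zero (by rintro rfl; omega)
  refine min_lt_width_X (fun i => Nat.two_pow_pos _) (e := ℓ * (2 * g + 3)) (d := m + 2 * g + 5)
    (fun M _ => ?_) ?_ ?_
  · calc ℓ * ∑ i ∈ range (M + 1), 2 ^ (i / ℓ) ≤ ℓ * (ℓ * 2 ^ (M / ℓ + 1)) := by
          refine Nat.mul_le_mul_left _ (le_trans ?_ (sum_two_pow_div_le _ _))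
          exact sum_le_sum_of_subset (range_mono (Nat.lt_mul_div_succ M hℓ))
      _ = ℓ * ℓ * 2 ^ (M / ℓ + 1) := by ring
      _ < 2 ^ (2 * g + 2) * 2 ^ (M / ℓ + 1) := Nat.mul_lt_mul_of_pos_right hsq (by positivity)
      _ = 2 ^ ((M + ℓ * (2 * g + 3)) / ℓ) := by rw [Nat.add_mul_div_left _ _ hℓ]; ring
      _ ≤ 2 ^ ((M + ℓ * (2 * g + 3) + 1) / ℓ) :=
        Nat.pow_le_pow_right two_pos (Nat.div_le_div_right (Nat.le_succ _))
  · rw [Nat.sub_add_cancel (by omega), mul_comm m]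
    calc 2 * (∑ i ∈ range (ℓ * m), 2 ^ (i / ℓ)) * (2 * ℓ + 2) ≤ 2 * (ℓ * 2 ^ m) * (4 * ℓ) :=
          Nat.mul_le_mul (Nat.mul_le_mul_left _ (sum_two_pow_div_le ℓ m)) (by omega)
      _ = ℓ * ℓ * (2 ^ m * 8) := by ring
      _ < 2 ^ (2 * g + 2) * (2 ^ m * 8) := Nat.mul_lt_mul_of_pos_right hsq (by positivity)
      _ = 2 ^ (m + 2 * g + 5) := by ring
  · rw [show ℓ * (2 * g + 3) + 2 + (m + 2 * g + 5) = ℓ * (2 * g + 3) + m + 2 * g + 7 by ring]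
    omega

theorem div_eight_lt_width_Y {ℓ : ℕ} (hℓ : 9 ≤ ℓ) : ℓ / 8 < width (Y ℓ) := by
  set m := ⌊(ℓ : ℝ) * Real.logb 2 ℓ⌋₊
  set g := Nat.log 2 ℓ
  have hgm : ℓ * g ≤ m := by
    refine Nat.le_floor ?_
    push_cast
    exact mul_le_mul_of_nonneg_left (Real.natLog_le_logb ℓ 2) (Nat.cast_nonneg ℓ)
  have hg : 1 ≤ g := Nat.log_pos one_lt_two (by omega)
  have hℓg : ℓ ≤ ℓ * g := Nat.le_mul_of_pos_right ℓ hg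
  have hsum : ℓ * (2 * g + 3) + m + 2 * g + 7 ≤ 7 * m := by
    have : 9 * g ≤ ℓ * g := Nat.mul_le_mul_right g hℓ
    linarith
  have hk : ℓ / 8 * (7 * m) + 2 ≤ m * ℓ := by
    have : m * (8 * (ℓ / 8)) ≤ m * ℓ := Nat.mul_le_mul_left m (Nat.mul_div_le ℓ 8)
    have : 2 ≤ m * (ℓ / 8) := Nat.mul_le_mul (by omega : 2 ≤ m) (by omega : 1 ≤ ℓ / 8)
    linarith
  rw [← min_eq_right (Nat.div_le_self ℓ 8)]
  refine min_lt_width_Y₂ (Nat.lt_pow_succ_log_self one_lt_two ℓ) (le_trans ?_ hk)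
  gcongr

lemma two_pow_le_length_Y₂ {m ℓ : ℕ} (hmℓ : 0 < m * ℓ) :
    2 ^ (m * ℓ) ≤ (Y₂ m ℓ).toList.length := by
  have h := two_pow_le_len (a := fun i => 2 ^ (i / ℓ)) (fun _ => Nat.two_pow_pos _) (m * ℓ - 1)
  rwa [Nat.sub_add_cancel hmℓ] at h

lemma length_Y₂_le {m ℓ : ℕ} (hmℓ : 0 < m * ℓ) :
    (Y₂ m ℓ).toList.length ≤ 2 ^ (m * ℓ) * (ℓ * 2 ^ m) := by
  refine (len_le (fun i => 2 ^ (i / ℓ)) (m * ℓ - 1)).trans ?_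
  rw [Nat.sub_add_cancel hmℓ]
  refine Nat.mul_le_mul_left _ ?_
  rw [mul_comm m]
  exact sum_two_pow_div_le ℓ m

lemma logb_length_Y_mem_Icc {ℓ : ℕ} (hℓ : 2 ≤ ℓ) :
    Real.logb 2 (Y ℓ).toList.length ∈
      Set.Icc (ℓ ^ 2 * Real.logb 2 ℓ / 2) (2 * (ℓ ^ 2 * Real.logb 2 ℓ)) := by
  have hℓ' : (2 : ℝ) ≤ ℓ := mod_cast hℓ
  have hlog : 1 ≤ Real.logb 2 ℓ := by
    rwa [Real.le_logb_iff_rpow_le one_lt_two (by positivity), Real.rpow_one]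
  set c := Real.logb 2 ℓ
  set m := ⌊(ℓ : ℝ) * c⌋₊
  have hm_le : (m : ℝ) ≤ ℓ * c := Nat.floor_le (by positivity)
  have hm_lt : ℓ * c < m + 1 := Nat.lt_floor_add_one _
  have hmpos : 0 < m * ℓ := Nat.mul_pos (Nat.floor_pos.2 (by nlinarith)) (by omega)
  have hlower : (2 : ℝ) ^ (m * ℓ) ≤ (Y ℓ).toList.length := mod_cast two_pow_le_length_Y₂ hmpos
  have hupper : ((Y ℓ).toList.length : ℝ) ≤ 2 ^ (m * ℓ) * (ℓ * 2 ^ m) :=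
    mod_cast length_Y₂_le hmpos
  have hlogpow : ∀ n : ℕ, Real.logb 2 ((2 : ℝ) ^ n) = n := fun n => by
    rw [Real.logb_pow, Real.logb_self_eq_one one_lt_two, mul_one]
  constructor
  · calc ℓ ^ 2 * c / 2 ≤ (m * ℓ : ℕ) := by push_cast; nlinarith
      _ = Real.logb 2 (2 ^ (m * ℓ)) := (hlogpow _).symm
      _ ≤ _ := Real.logb_le_logb_of_le one_lt_two (by positivity) hlower
  · calc _ ≤ Real.logb 2 (2 ^ (m * ℓ) * (ℓ * 2 ^ m)) := by
          refine Real.logb_le_logb_of_le one_lt_two (lt_of_lt_of_le ?_ hlower) hupper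
          positivity
      _ = (m * ℓ : ℕ) + (c + m) := by
          rw [Real.logb_mul (by positivity) (by positivity), Real.logb_mul (by positivity)
            (by positivity), hlogpow, hlogpow]
      _ ≤ 2 * (ℓ ^ 2 * c) := by
          push_cast
          nlinarith [mul_nonneg (by linarith : 0 ≤ c) (by nlinarith : (0 : ℝ) ≤ ℓ ^ 2 - ℓ - 1)]

lemma sqrtLogRatio_Y_mem_Icc {ℓ : ℕ} (hℓ : 2 ≤ ℓ) :
    sqrtLogRatio (Y ℓ) ∈ Set.Icc ((ℓ : ℝ) / 3) (2 * ℓ) := by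
  have hℓ' : (2 : ℝ) ≤ ℓ := mod_cast hℓ
  have hlog : 1 ≤ Real.logb 2 ℓ := by
    rwa [Real.le_logb_iff_rpow_le one_lt_two (by positivity), Real.rpow_one]
  have hlog_le : Real.logb 2 ℓ ≤ ℓ := by
    rw [Real.logb_le_iff_le_rpow one_lt_two (by positivity), Real.rpow_natCast]
    exact_mod_cast Nat.lt_two_pow_self.le
  obtain ⟨hlower, hupper⟩ := logb_length_Y_mem_Icc hℓ
  rw [sqrtLogRatio]
  set c := Real.logb 2 ℓ
  set A := Real.logb 2 (Y ℓ).toList.length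
  have hA : ℓ ≤ A := le_trans (by nlinarith) hlower
  have hloglog_ge : c ≤ Real.logb 2 A :=
    Real.logb_le_logb_of_le one_lt_two (by positivity) hA
  have hloglog_le : Real.logb 2 A ≤ 4 * c := by
    have hA' : A ≤ (ℓ : ℝ) ^ 4 := by
      calc A ≤ 2 * (ℓ ^ 2 * c) := hupper
        _ ≤ ℓ * (ℓ ^ 2 * ℓ) := by gcongr
        _ = (ℓ : ℝ) ^ 4 := by ring
    calc Real.logb 2 A ≤ Real.logb 2 (ℓ ^ 4) :=
          Real.logb_le_logb_of_le one_lt_two (by linarith) hA'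
      _ = 4 * c := by rw [Real.logb_pow]; norm_cast
  have hpos : 0 < Real.logb 2 A := by linarith
  constructor
  · refine Real.le_sqrt_of_sq_le ((le_div_iff₀ hpos).2 ?_)
    nlinarith [mul_le_mul_of_nonneg_left hloglog_le (sq_nonneg (ℓ / 3 : ℝ)), sq_nonneg (ℓ : ℝ)]
  · refine Real.sqrt_le_iff.2 ⟨by positivity, (div_le_iff₀ hpos).2 ?_⟩
    nlinarith [mul_le_mul_of_nonneg_left hloglog_ge (sq_nonneg (2 * ℓ : ℝ)), sq_nonneg (ℓ : ℝ)]

lemma isTheta_sqrtLogRatio_Y :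
    (fun ℓ : ℕ => sqrtLogRatio (Y ℓ)) =Θ[Filter.atTop] fun ℓ : ℕ => (ℓ : ℝ) := by
  have hnorm : ∀ ℓ, ‖sqrtLogRatio (Y ℓ)‖ = sqrtLogRatio (Y ℓ) := fun ℓ =>
    Real.norm_of_nonneg (Real.sqrt_nonneg _)
  constructor
  · refine Asymptotics.IsBigO.of_bound 2 ?_
    filter_upwards [Filter.eventually_ge_atTop 2] with ℓ hℓ
    rw [hnorm, Real.norm_natCast]
    exact (sqrtLogRatio_Y_mem_Icc hℓ).2
  · refine Asymptotics.IsBigO.of_bound 3 ?_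
    filter_upwards [Filter.eventually_ge_atTop 2] with ℓ hℓ
    rw [hnorm, Real.norm_natCast]
    linarith [(sqrtLogRatio_Y_mem_Icc hℓ).1]

end Dyck

theorem mainTheorem3 :
    (∃ c : ℝ, 0 < c ∧ ∀ᶠ ℓ : ℕ in Filter.atTop,
      c * Dyck.sqrtLogRatio (Dyck.Y ℓ) ≤ (Dyck.width (Dyck.Y ℓ) : ℝ)) ∧
    (∃ c : ℝ, 0 < c ∧ ∀ᶠ ℓ : ℕ in Filter.atTop,
      c * (ℓ : ℝ) ≤ (Dyck.width (Dyck.Y ℓ) : ℝ)) ∧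
    Asymptotics.IsTheta Filter.atTop
      (fun ℓ : ℕ => Dyck.sqrtLogRatio (Dyck.Y ℓ)) (fun ℓ : ℕ => (ℓ : ℝ)) := by
  have hlinear : ∀ᶠ ℓ : ℕ in Filter.atTop, (1 / 8 : ℝ) * ℓ ≤ Dyck.width (Dyck.Y ℓ) := by
    filter_upwards [Filter.eventually_ge_atTop 9] with ℓ hℓ
    have hwidth := Dyck.div_eight_lt_width_Y hℓ
    have hcast : (ℓ : ℝ) ≤ (8 * Dyck.width (Dyck.Y ℓ) : ℕ) := mod_cast (by omega)
    push_cast at hcast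
    linarith
  refine ⟨⟨1 / 16, by norm_num, ?_⟩, ⟨1 / 8, by norm_num, hlinear⟩, Dyck.isTheta_sqrtLogRatio_Y⟩
  filter_upwards [hlinear, Filter.eventually_ge_atTop 2] with ℓ hwidth hℓ
  linarith [(Dyck.sqrtLogRatio_Y_mem_Icc hℓ).2]
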